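/- Fix $d\ge 2$ and a finite vertex set $V$ with $n=|V|$. A directed pseudorange graph is a simple directed graph $\Gamma=(V,E)$ (no loops; for $u\neq v$ it may contain the arc $uv$, the arc $vu$, both, or none); its underlying undirected graph $\tilde\Gamma=(V,\tilde E)$ is the undirected multigraph in which every arc $uv\in E$ contributes one copy of the edge $\{u,v\}$. An undirected pseudorange graph is a multigraph arising in this way. A $d$-dimensional pseudorange configuration is a vector $p=(x_v,\beta_v)_{v\in V}\in\mathbb{R}^{n(d+1)}$ with positions $x_v\in\mathbb{R}^d$ and clock biases $\beta_v\in\mathbb{R}$; the pair $(\Gamma,p)$ is a pseudorange framework. It is generic if the $nd$ spatial coordinates (the coordinates of the $x_v$) are not a root of any nonzero polynomial with integer coefficients. Put $f_{uv}(p)=\|x_u-x_v\|+\beta_v-\beta_u$ (Euclidean norm). The framework $(\Gamma,p)$ is rigid if there is $\epsilon>0$ such that every configuration $p'$ with $\|p-p'\|<\epsilon$ and $f_{uv}(p')=f_{uv}(p)$ for all arcs $uv$ of $\Gamma$ satisfies $f_{uv}(p')=f_{uv}(p)$ for all $u\ne v$ in $V$. Let $\tilde\Gamma$ be an undirected pseudorange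 graph on $V$. Then exactly one of the following holds: every generic $d$-dimensional pseudorange framework whose underlying undirected graph is $\tilde\Gamma$ is rigid, or no such framework is rigid. In the first case $\tilde\Gamma$ is said to be rigid in $\mathbb{R}^d$. -/

import Mathlib

/-- A directed pseudorange graph on the vertex set `V`: a simple directed graph, that is, a
digraph without loops. For `u ≠ v` it may contain the arc `uv`, the arc `vu`, both or none. -/
structure PseudorangeGraph (V : Type*) extends Digraph V where
  loopless : ∀ v, ¬ Adj v v

namespace PseudorangeGraph

/-- The complete directed graph, with arc set `{uv | u ≠ v}`. -/
def complete (V : Type*) : PseudorangeGraph V where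
  Adj u v := u ≠ v
  loopless _ h := h rfl

open Classical in
/-- The multiset of the undirected edges of the underlying undirected multigraph of `Γ`:
each arc `uv` contributes one copy of the unordered pair `{u, v}`, so `{u, v}` has multiplicity
`0`, `1` or `2`. -/
noncomputable def underlying {V : Type*} [Fintype V] (Γ : PseudorangeGraph V) :
    Multiset (Sym2 V) :=
  (Finset.univ.filter fun a : V × V => Γ.Adj a.1 a.2).val.map fun a => s(a.1, a.2)

end PseudorangeGraph

/-- An undirected pseudorange graph on `V`, given by its multiset of edges: an undirected
multigraph that is induced by some (simple) directed pseudorange graph on `V`. -/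
def IsUndirectedPseudorangeGraph {V : Type*} [Fintype V] (E : Multiset (Sym2 V)) : Prop :=
  ∃ Γ : PseudorangeGraph V, Γ.underlying = E

/-- A `d`-dimensional pseudorange configuration of the agents `V`: a vector of `ℝ^{n(d+1)}` with
`n = |V|`, carrying the Euclidean norm. The entry `Sum.inl (v, i)` is the `i`-th spatial
coordinate of agent `v` and the entry `Sum.inr v` is its clock bias. -/
abbrev PseudorangeConfig (V : Type*) (d : ℕ) : Type _ :=
  EuclideanSpace ℝ ((V × Fin d) ⊕ V)

namespace PseudorangeConfig

/-- The position `x_v ∈ ℝ^d` of agent `v`. -/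
def position {V : Type*} {d : ℕ} (p : PseudorangeConfig V d) (v : V) :
    EuclideanSpace ℝ (Fin d) :=
  WithLp.toLp 2 fun i => p (Sum.inl (v, i))

/-- The clock bias `β_v` of agent `v`. -/
def bias {V : Type*} {d : ℕ} (p : PseudorangeConfig V d) (v : V) : ℝ :=
  p (Sum.inr v)

/-- The pseudorange from `u` to `v`: `‖x_u - x_v‖ + β_v - β_u`. -/
noncomputable def pseudorange {V : Type*} {d : ℕ} (p : PseudorangeConfig V d) (u v : V) : ℝ :=
  ‖p.position u - p.position v‖ + p.bias v - p.bias u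

/-- A configuration is generic if its spatial coordinates are not a root of any nonzero
polynomial with integer coefficients. The clock biases are unrestricted. -/
def IsGeneric {V : Type*} {d : ℕ} (p : PseudorangeConfig V d) : Prop :=
  ∀ P : MvPolynomial (V × Fin d) ℤ, P ≠ 0 →
    MvPolynomial.aeval (fun i : V × Fin d => p (Sum.inl i)) P ≠ 0

end PseudorangeConfig

namespace PseudorangeGraph

/-- The frameworks `(Γ, p)` and `(Γ, p')` are equivalent: all the pseudoranges along the arcs of
`Γ` agree. -/
def Equivalent {V : Type*} {d : ℕ} (Γ : PseudorangeGraph V) (p p' : PseudorangeConfig V d) :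
    Prop :=
  ∀ u v, Γ.Adj u v → p.pseudorange u v = p'.pseudorange u v

/-- Congruence of frameworks on the configurations `p` and `p'`: equivalence for the complete
directed graph. -/
def Congruent {V : Type*} {d : ℕ} (p p' : PseudorangeConfig V d) : Prop :=
  (complete V).Equivalent p p'

/-- The framework `(Γ, p)` is rigid: every configuration that is close enough to `p` and
equivalent to it is congruent to it. -/
def IsRigid {V : Type*} [Fintype V] {d : ℕ} (Γ : PseudorangeGraph V)
    (p : PseudorangeConfig V d) : Prop :=
  ∃ ε > 0, ∀ p' : PseudorangeConfig V d, ‖p - p'‖ < ε → Γ.Equivalent p p' → Congruent p p'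

end PseudorangeGraph

/-- The undirected pseudorange graph with edge multiset `E` is rigid in `ℝ^d`: every generic
`d`-dimensional pseudorange framework with this underlying undirected graph is rigid. -/
def IsRigidUndirectedGraph {V : Type*} [Fintype V] (d : ℕ) (E : Multiset (Sym2 V)) : Prop :=
  ∀ (Γ : PseudorangeGraph V) (p : PseudorangeConfig V d),
    Γ.underlying = E → p.IsGeneric → Γ.IsRigid p

/-! Near a generic configuration every linear dependency among pseudorange gradients persists. The
implicit function theorem then makes rigidity equivalent to infinitesimal rigidity: the gradients
along the arcs span the gradients along all pairs (`isRigid_iff_isInfinitesimallyRigid`). It remains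
to see that this linear condition depends neither on the generic configuration nor on the directions
of the arcs.

The entries of the gradients lie in the field generated by coordinates and distances. For `d ≥ 2` no
nonempty product of distinct squared distances is a square of a rational function, so the distances
are independent square roots whose signs can be prescribed freely: one abstract field embeds in `ℝ`
through the coordinates and distances of `p`, and also through those of `p'` with arbitrary signs
(`exists_common_field`). Changing the sign of a distance turns the row of `uv` into minus the row of
`vu` (`rigidityRow_neg`), so a single algebraic argument handles both the change of configuration
and the reversal of arcs (`linearIndepOn_grad_iff`). Digraphs with the same multigraph differ only
by such reversals. -/

open MvPolynomial in
/-- The squared distance between the agents of an unordered pair, as a polynomial in the spatial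
coordinates. -/
noncomputable def distSqPoly {V : Type*} (d : ℕ) : Sym2 V → MvPolynomial (V × Fin d) ℤ :=
  Sym2.lift ⟨fun u v => ∑ i, (X (u, i) - X (v, i)) ^ 2, fun u v =>
    Finset.sum_congr rfl fun i _ => by ring⟩

/-! ### Independent square roots -/

/-- Simultaneous adjunction of square roots: if no nonempty subproduct of the `a i` is a square,
then two embeddings of `K` extend to a common field that contains square roots of the `a i`, with
any prescribed values at these roots. -/
theorem exists_field_adjoin_sqrt.{u} {ι L : Type*} [Field L] (s : Finset ι) :
    ∀ {K : Type u} [Field K] [CharZero K] (a : ι → K)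
      (_ : ∀ T ⊆ s, T.Nonempty → ¬ IsSquare (∏ i ∈ T, a i)) (φ φ' : K →+* L) (t t' : ι → L)
      (_ : ∀ i ∈ s, t i ^ 2 = φ (a i)) (_ : ∀ i ∈ s, t' i ^ 2 = φ' (a i)),
      ∃ (M : Type u) (_ : Field M) (j : K →+* M) (ψ ψ' : M →+* L) (b : ι → M),
        ψ.comp j = φ ∧ ψ'.comp j = φ' ∧ ∀ i ∈ s, ψ (b i) = t i ∧ ψ' (b i) = t' i := by
  classical
  induction s using Finset.induction_on with
  | empty =>
    intro K _ _ a _ φ φ' t t' _ _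
    exact ⟨K, inferInstance, RingHom.id K, φ, φ', 0, rfl, rfl, by simp⟩
  | insert n s hn ih =>
    intro K _ _ a ha φ φ' t t' ht ht'
    have hsq : ¬ IsSquare (a n) := by
      simpa using ha {n} (by simp) (by simp)
    -- The hypothesis survives the adjunction of `√(a n)`: if `(x + y√(a n))²` lies in `K`, then
    -- `2xy = 0`, so it equals `x²` or `a n * y²`. The second case makes the product over `insert n
    -- T` a square in `K`.
    have key : ∀ T ⊆ s, T.Nonempty →
        ¬ IsSquare (∏ i ∈ T, algebraMap K (QuadraticAlgebra K (a n) 0) (a i)) := by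
      rintro T hT hTne ⟨z, hz⟩
      rw [← map_prod] at hz
      have hre := congrArg QuadraticAlgebra.re hz
      have him := congrArg QuadraticAlgebra.im hz
      simp only [QuadraticAlgebra.re_mul, QuadraticAlgebra.im_mul,
        QuadraticAlgebra.algebraMap_re, QuadraticAlgebra.algebraMap_im] at hre him
      have him' : z.re * z.im = 0 := by
        have : (2 : K) * (z.re * z.im) = 0 := by linear_combination -him
        simpa using this
      rcases mul_eq_zero.1 him' with h | h
      · apply ha (insert n T) (Finset.insert_subset_insert n hT) (by simp)
        rw [Finset.prod_insert (fun h => hn (hT h))]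
        exact ⟨a n * z.im, by rw [hre, h]; ring⟩
      · exact ha T (hT.trans (Finset.subset_insert n s)) hTne ⟨z.re, by rw [hre, h]; ring⟩
    have : Fact (∀ r : K, r ^ 2 ≠ a n + 0 * r) :=
      ⟨fun r hr => hsq ⟨r, by rw [← sq, hr]; ring⟩⟩
    have lift : ∀ (χ : K →+* L) (r : L), r ^ 2 = χ (a n) →
        ∃ χ' : QuadraticAlgebra K (a n) 0 →+* L,
          χ'.comp (algebraMap K (QuadraticAlgebra K (a n) 0)) = χ ∧
          χ' QuadraticAlgebra.omega = r := by
      intro χ r hr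
      let := χ.toAlgebra
      refine ⟨(QuadraticAlgebra.lift ⟨r, ?_⟩ : QuadraticAlgebra K (a n) 0 →ₐ[K] L).toRingHom,
        ?_, ?_⟩
      · rw [← sq, hr, Algebra.smul_def, mul_one, zero_smul, add_zero]; rfl
      · ext x
        exact (QuadraticAlgebra.lift _ : QuadraticAlgebra K (a n) 0 →ₐ[K] L).commutes x
      · exact congrArg Subtype.val (QuadraticAlgebra.lift.symm_apply_apply _)
    obtain ⟨χ, hχ, hχn⟩ := lift φ (t n) (ht n (by simp))
    obtain ⟨χ', hχ', hχn'⟩ := lift φ' (t' n) (ht' n (by simp))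
    obtain ⟨M', fM', j, ψ, ψ', b, h1, h2, h3⟩ :=
      ih (fun i => algebraMap K (QuadraticAlgebra K (a n) 0) (a i)) key
      χ χ' t t'
      (fun i hi => by rw [ht i (by simp [hi]), ← hχ]; rfl)
      (fun i hi => by rw [ht' i (by simp [hi]), ← hχ']; rfl)
    refine ⟨M', fM', j.comp (algebraMap K (QuadraticAlgebra K (a n) 0)), ψ, ψ',
      Function.update b n (j QuadraticAlgebra.omega), ?_, ?_, ?_⟩
    · rw [← RingHom.comp_assoc, h1, hχ]
    · rw [← RingHom.comp_assoc, h2, hχ']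
    · intro i hi
      rcases Finset.mem_insert.1 hi with rfl | hi
      · simp only [Function.update_self]
        exact ⟨by rw [← hχn, ← h1]; rfl, by rw [← hχn', ← h2]; rfl⟩
      · have : i ≠ n := fun h => hn (h ▸ hi)
        simpa [Function.update_of_ne this] using h3 i hi

/-! ### Squared distances are independent modulo squares -/

/-- A complex polynomial with a simple root is not a square. -/
theorem not_isSquare_of_simple_root {F : Polynomial ℂ} {z : ℂ} (h0 : F.eval z = 0)
    (h1 : F.derivative.eval z ≠ 0) : ¬ IsSquare F := by
  rintro ⟨G, rfl⟩
  have hG : G.eval z = 0 := by simpa using h0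
  simp [Polynomial.derivative_mul, hG] at h1

/-- Some specialisation to one complex variable gives the product a simple root. A second coordinate
is essential: on a line the squared distances are themselves squares. -/
theorem distSqPoly_prod_not_isSquare {V : Type*} [Fintype V] {d : ℕ} (hd : 2 ≤ d)
    (T : Finset (Sym2 V)) (hT : ∀ e ∈ T, ¬ e.IsDiag) (hne : T.Nonempty) :
    ¬ IsSquare (∏ e ∈ T, distSqPoly d e) := by
  classical
  obtain ⟨e₀, he₀⟩ := hne
  induction e₀ using Sym2.ind with
  | _ u v =>
  have huv : u ≠ v := by simpa using hT _ he₀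
  let c : V → ℝ := fun w => ((Fintype.equivFin V w : ℕ) : ℝ) - (Fintype.equivFin V v : ℕ)
  have hc : Function.Injective c := by
    intro w w' h
    have : ((Fintype.equivFin V w : ℕ) : ℝ) = (Fintype.equivFin V w' : ℕ) := by
      simpa [c] using h
    exact (Fintype.equivFin V).injective (Fin.ext (by exact_mod_cast this))
  have hcv : c v = 0 := by simp [c]
  let i0 : Fin d := ⟨0, by omega⟩
  let i1 : Fin d := ⟨1, by omega⟩
  have hi : i1 ≠ i0 := by simp [i0, i1]
  -- Agent `u` moves along `(X, 1, 0, …)`, while the others sit at distinct integers `c w` on the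
  -- first axis, with `v` at the origin. The pair `uw` then gives `(X - c w)² + 1`, with roots `c w
  -- ± i`, and every other pair a nonzero constant. Hence only the factor of `uv` vanishes at `i`,
  -- and it does so simply.
  let x : V × Fin d → Polynomial ℂ := fun a =>
    if a.1 = u then (if a.2 = i0 then Polynomial.X else if a.2 = i1 then 1 else 0)
    else if a.2 = i0 then Polynomial.C (c a.1 : ℂ) else 0
  let θ : MvPolynomial (V × Fin d) ℤ →+* Polynomial ℂ := (MvPolynomial.aeval x).toRingHom
  have hθ : ∀ w w', θ (distSqPoly d s(w, w')) = ∑ i, (x (w, i) - x (w', i)) ^ 2 := by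
    intro w w'
    simp [θ, distSqPoly]
  have hθu : ∀ w, w ≠ u →
      θ (distSqPoly d s(u, w)) = (Polynomial.X - Polynomial.C (c w : ℂ)) ^ 2 + 1 := by
    intro w hw
    rw [hθ, ← Finset.add_sum_erase _ _ (Finset.mem_univ i0),
      ← Finset.add_sum_erase _ _ (Finset.mem_erase.2 ⟨hi, Finset.mem_univ i1⟩),
      Finset.sum_eq_zero]
    · simp [x, hw, hi]
    · intro i h
      simp only [Finset.mem_erase] at h
      simp [x, hw, h.1, h.2.1]
  have hθn : ∀ w w', w ≠ u → w' ≠ u →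
      θ (distSqPoly d s(w, w')) = Polynomial.C (((c w - c w' : ℝ) : ℂ) ^ 2) := by
    intro w w' hw hw'
    rw [hθ, ← Finset.add_sum_erase _ _ (Finset.mem_univ i0), Finset.sum_eq_zero]
    · simp [x, hw, hw']
    · intro i h
      simp only [Finset.mem_erase] at h
      simp [x, hw, hw', h.1]
  have hu : ∀ w, w ≠ u → w ≠ v → (θ (distSqPoly d s(u, w))).eval Complex.I ≠ 0 := by
    intro w hw hwv h
    rw [hθu w hw] at h
    have h2 : (c w : ℂ) * (c w - 2 * Complex.I) = 0 := by
      simp only [Polynomial.eval_add, Polynomial.eval_pow, Polynomial.eval_sub, Polynomial.eval_X,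
        Polynomial.eval_C, Polynomial.eval_one] at h
      linear_combination h - Complex.I_sq
    rcases mul_eq_zero.1 h2 with h | h
    · exact hwv (hc (by rw [hcv]; exact_mod_cast h))
    · simpa using congrArg Complex.im h
  have hne : ∀ e ∈ T.erase s(u, v), (θ (distSqPoly d e)).eval Complex.I ≠ 0 := by
    intro e he
    rw [Finset.mem_erase] at he
    obtain ⟨he, heT⟩ := he
    have hdiag := hT e heT
    induction e using Sym2.ind with
    | _ w w' =>
    have hww : w ≠ w' := by simpa using hdiag
    by_cases h1 : w = u
    · subst h1
      exact hu w' (Ne.symm hww) fun h => he (by rw [h])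
    by_cases h2 : w' = u
    · subst h2
      rw [Sym2.eq_swap]
      exact hu w h1 fun h => he (by rw [h, Sym2.eq_swap])
    rw [hθn w w' h1 h2, Polynomial.eval_C]
    refine pow_ne_zero _ ?_
    exact_mod_cast sub_ne_zero.2 fun h => hww (hc h)
  intro hsq
  have hsq' := hsq.map θ
  rw [map_prod, ← Finset.mul_prod_erase _ _ he₀, hθu v huv.symm, hcv] at hsq'
  refine not_isSquare_of_simple_root (z := Complex.I) ?_ ?_ hsq'
  · simp
  · have : (∏ e ∈ T.erase s(u, v), θ (distSqPoly d e)).eval Complex.I ≠ 0 := by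
      rw [Polynomial.eval_prod]
      exact Finset.prod_ne_zero_iff.2 hne
    simp [Polynomial.derivative_mul, this]

/-- The polynomial ring is integrally closed, so a square root in the fraction field is already a
polynomial. -/
theorem distSqPoly_prod_not_isSquare_fractionRing {V : Type*} [Fintype V] {d : ℕ} (hd : 2 ≤ d)
    (T : Finset (Sym2 V)) (hT : ∀ e ∈ T, ¬ e.IsDiag) (hne : T.Nonempty) :
    ¬ IsSquare (∏ e ∈ T, algebraMap _ (FractionRing (MvPolynomial (V × Fin d) ℤ))
      (distSqPoly d e)) := by
  rintro ⟨r, hr⟩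
  rw [← map_prod] at hr
  obtain ⟨y, rfl⟩ := IsIntegrallyClosed.exists_algebraMap_eq_of_isIntegral_pow
    (R := MvPolynomial (V × Fin d) ℤ) (x := r) two_pos
    (by rw [sq, ← hr]; exact isIntegral_algebraMap)
  rw [← map_mul] at hr
  exact distSqPoly_prod_not_isSquare hd T hT hne
    ⟨y, IsFractionRing.injective _ (FractionRing (MvPolynomial (V × Fin d) ℤ)) hr⟩

/-- The field of functions generated by the coordinates and the distances: for generic
configurations `p` and `p'` and any choice of signs of the distances, the coordinates and signed
distances of `p` and of `p'` are the images of the same elements of one field. -/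
theorem exists_common_field.{u} {V : Type u} [Fintype V] {d : ℕ} (hd : 2 ≤ d)
    {p p' : PseudorangeConfig V d} (hp : p.IsGeneric) (hp' : p'.IsGeneric)
    (t t' : Sym2 V → ℝ)
    (ht : ∀ u v, t s(u, v) ^ 2 = ‖p.position u - p.position v‖ ^ 2)
    (ht' : ∀ u v, t' s(u, v) ^ 2 = ‖p'.position u - p'.position v‖ ^ 2) :
    ∃ (M : Type u) (_ : Field M) (ψ ψ' : M →+* ℝ) (y : V × Fin d → M) (b : Sym2 V → M),
      (∀ i, ψ (y i) = p (Sum.inl i)) ∧ (∀ i, ψ' (y i) = p' (Sum.inl i)) ∧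
        ∀ e, ψ (b e) = t e ∧ ψ' (b e) = t' e := by
  classical
  let R := MvPolynomial (V × Fin d) ℤ
  let K := FractionRing R
  have embed : ∀ q : PseudorangeConfig V d, q.IsGeneric →
      ∃ φ : K →+* ℝ, ∀ P : R, φ (algebraMap R K P) =
        MvPolynomial.aeval (fun i : V × Fin d => q (Sum.inl i)) P := by
    intro q hq
    have hinj : Function.Injective
        (MvPolynomial.aeval (R := ℤ) (fun i : V × Fin d => q (Sum.inl i))).toRingHom := by
      refine (injective_iff_map_eq_zero _).2 fun P hP => ?_
      by_contra h
      exact hq P h hP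
    exact ⟨IsFractionRing.lift hinj, fun P => IsFractionRing.lift_algebraMap hinj P⟩
  obtain ⟨φ, hφ⟩ := embed p hp
  obtain ⟨φ', hφ'⟩ := embed p' hp'
  have hdist : ∀ (q : PseudorangeConfig V d) (u v : V), ‖q.position u - q.position v‖ ^ 2 =
      MvPolynomial.aeval (fun i : V × Fin d => q (Sum.inl i)) (distSqPoly d s(u, v)) := by
    intro q u v
    simp [distSqPoly, EuclideanSpace.norm_sq_eq, PseudorangeConfig.position]
  let s : Finset (Sym2 V) := Finset.univ.filter fun e => ¬ e.IsDiag
  obtain ⟨M, _, j, ψ, ψ', b, h1, h2, h3⟩ := exists_field_adjoin_sqrt s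
    (fun e => algebraMap R K (distSqPoly d e))
    (fun T hT hne => distSqPoly_prod_not_isSquare_fractionRing hd T
      (fun e he => (Finset.mem_filter.1 (hT he)).2) hne) φ φ' t t'
    (fun e _ => by
      induction e using Sym2.ind with
      | _ u v => rw [ht, hφ, hdist])
    (fun e _ => by
      induction e using Sym2.ind with
      | _ u v => rw [ht', hφ', hdist])
  refine ⟨M, inferInstance, ψ, ψ', fun i => j (algebraMap R K (MvPolynomial.X i)),
    -- Diagonal pairs have squared distance `0`, a square, and are therefore kept out of the
    -- adjunction.
    fun e => if e.IsDiag then 0 else b e, ?_, ?_, ?_⟩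
  · intro i
    rw [← RingHom.comp_apply, h1, hφ, MvPolynomial.aeval_X]
  · intro i
    rw [← RingHom.comp_apply, h2, hφ', MvPolynomial.aeval_X]
  · intro e
    by_cases he : e.IsDiag
    · induction e using Sym2.ind with
      | _ u v =>
      obtain rfl : u = v := by simpa using he
      have h := ht u u
      have h' := ht' u u
      simp at h h'
      simp [h, h']
    · simpa [he] using h3 e (by simp [s, he])

/-! ### The rigidity matrix under field embeddings and arc reversal -/

open Classical in
/-- The row of the pseudorange rigidity matrix of the arc `uv`, over an arbitrary field, in terms
of the spatial coordinates `x` and the length `t` of the arc. -/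
noncomputable def rigidityRow {F V : Type*} [Field F] {d : ℕ} (x : V × Fin d → F) (t : F)
    (u v : V) : (V × Fin d) ⊕ V → F
  | Sum.inl (w, i) => ((if w = u then 1 else 0) - (if w = v then 1 else 0)) *
      ((x (u, i) - x (v, i)) / t)
  | Sum.inr w => (if w = v then 1 else 0) - (if w = u then 1 else 0)

theorem map_rigidityRow {F F' V : Type*} [Field F] [Field F'] {d : ℕ} (ψ : F →+* F')
    (x : V × Fin d → F) (t : F) (u v : V) (j : (V × Fin d) ⊕ V) :
    ψ (rigidityRow x t u v j) = rigidityRow (fun i => ψ (x i)) (ψ t) u v j := by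
  classical
  rcases j with ⟨w, i⟩ | w <;> simp [rigidityRow, apply_ite ψ]

/-- The spatial part is symmetric in `u, v` and odd in `t`; the bias part is antisymmetric and free
of `t`. Reversing an arc is thus, up to sign, a conjugation of its square root. -/
theorem rigidityRow_neg {F V : Type*} [Field F] {d : ℕ} (x : V × Fin d → F) (t : F) (u v : V)
    (j : (V × Fin d) ⊕ V) : rigidityRow x (-t) u v j = - rigidityRow x t v u j := by
  classical
  rcases j with ⟨w, i⟩ | w
  · simp only [rigidityRow, div_neg]
    ring
  · simp only [rigidityRow]
    ring

namespace PseudorangeConfig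

/-- The gradient at `p` of the pseudorange along an arc. -/
noncomputable def grad {V : Type*} {d : ℕ} (p : PseudorangeConfig V d) (a : V × V) :
    PseudorangeConfig V d :=
  WithLp.toLp 2 (rigidityRow (fun i => p (Sum.inl i)) ‖p.position a.1 - p.position a.2‖ a.1 a.2)

/-- The distance in `p` of an unordered pair of agents. -/
noncomputable def pairDist {V : Type*} {d : ℕ} (p : PseudorangeConfig V d) : Sym2 V → ℝ :=
  Sym2.lift ⟨fun u v => ‖p.position u - p.position v‖, fun _ _ => norm_sub_rev _ _⟩

end PseudorangeConfig

/-- Expresses independence by one polynomial in the entries, the Gram determinant, whose vanishing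
is preserved and reflected by field embeddings. -/
theorem linearIndependent_toLp_iff_det {κ ι : Type*} [Fintype κ] [DecidableEq κ] [Fintype ι]
    (A : Matrix κ ι ℝ) :
    LinearIndependent ℝ (fun k => (WithLp.toLp 2 (A k) : EuclideanSpace ℝ ι)) ↔
      (A * A.transpose).det ≠ 0 := by
  have h : Matrix.gram ℝ (fun k => (WithLp.toLp 2 (A k) : EuclideanSpace ℝ ι)) =
      A * A.transpose := by
    ext k l
    simp [Matrix.gram_apply, Matrix.mul_apply, PiLp.inner_apply, mul_comm]
  rw [← h]
  exact Matrix.det_gram_ne_zero_iff_linearIndependent.symm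

open Classical in
/-- Reversal of the arcs that join the unordered pairs in `S`. -/
noncomputable def flipArc {V : Type*} (S : Set (Sym2 V)) (a : V × V) : V × V :=
  if s(a.1, a.2) ∈ S then (a.2, a.1) else a

theorem flipArc_flipArc {V : Type*} (S : Set (Sym2 V)) (a : V × V) :
    flipArc S (flipArc S a) = a := by
  unfold flipArc
  by_cases h : s(a.1, a.2) ∈ S
  · simp [h, Sym2.eq_swap (a := a.2) (b := a.1)]
  · simp [h]

theorem flipArc_injective {V : Type*} (S : Set (Sym2 V)) : Function.Injective (flipArc S) :=
  Function.LeftInverse.injective (flipArc_flipArc S)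

theorem flipArc_empty {V : Type*} : flipArc (∅ : Set (Sym2 V)) = id := by
  funext a
  simp [flipArc]

/-- Linear independence of gradients is the same for all generic configurations and is not
affected by the reversal of arcs. -/
theorem linearIndepOn_grad_iff {V : Type*} [Fintype V] {d : ℕ} (hd : 2 ≤ d)
    {p p' : PseudorangeConfig V d} (hp : p.IsGeneric) (hp' : p'.IsGeneric) (S : Set (Sym2 V))
    (I : Set (V × V)) :
    LinearIndepOn ℝ p.grad I ↔ LinearIndepOn ℝ p'.grad (flipArc S '' I) := by
  classical
  let ε : Sym2 V → ℝˣ := fun e => if e ∈ S then -1 else 1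
  have hε : ∀ e, (ε e : ℝ) ^ 2 = 1 := by
    intro e
    by_cases h : e ∈ S <;> simp [ε, h]
  -- The distances of `p'` get the sign `-1` exactly on `S`, so `ψ'` sends the row of an arc to plus
  -- or minus the gradient of the flipped arc.
  obtain ⟨M, _, ψ, ψ', y, b, hy, hy', hb⟩ := exists_common_field hd hp hp' p.pairDist
    (fun e => ε e * p'.pairDist e) (fun u v => rfl)
    (fun u v => by rw [mul_pow, hε, one_mul]; rfl)
  let A : Matrix I ((V × Fin d) ⊕ V) M := fun a => rigidityRow y (b s(a.1.1, a.1.2)) a.1.1 a.1.2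
  have hA : ∀ (χ : M →+* ℝ) (a : I) (j : (V × Fin d) ⊕ V), A.map χ a j =
      rigidityRow (fun i => χ (y i)) (χ (b s(a.1.1, a.1.2))) a.1.1 a.1.2 j :=
    fun χ a j => map_rigidityRow χ y _ _ _ j
  have map_det : ∀ χ : M →+* ℝ, ((A.map χ) * (A.map χ).transpose).det =
      χ ((A * A.transpose).det) := by
    intro χ
    rw [RingHom.map_det, RingHom.mapMatrix_apply, Matrix.map_mul, Matrix.transpose_map]
  have h1 : (fun a : I => p.grad a) = fun a => WithLp.toLp 2 (A.map ψ a) := by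
    funext a
    refine congrArg (WithLp.toLp 2) (funext fun j => ?_)
    rw [hA, (hb _).1]
    simp only [hy]
    rfl
  have h2 : (fun a : I => ε s(a.1.1, a.1.2) • p'.grad (flipArc S a)) =
      fun a => WithLp.toLp 2 (A.map ψ' a) := by
    funext a
    ext j
    simp only [hA, hy', (hb _).2]
    by_cases h : s(a.1.1, a.1.2) ∈ S
    · simp only [ε, h, flipArc, if_true, Units.val_neg, Units.val_one, neg_one_mul,
        rigidityRow_neg]
      simp [PseudorangeConfig.grad, PseudorangeConfig.pairDist, norm_sub_rev]
    · simp [ε, h, flipArc, PseudorangeConfig.grad, PseudorangeConfig.pairDist]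
  have h3 : LinearIndepOn ℝ p'.grad (flipArc S '' I) ↔
      LinearIndepOn ℝ (p'.grad ∘ flipArc S) I :=
    ⟨fun h => h.comp_of_image (flipArc_injective S).injOn,
      LinearIndepOn.image_of_comp _ _⟩
  have h4 : LinearIndepOn ℝ (p'.grad ∘ flipArc S) I ↔
      LinearIndependent ℝ (fun a : I => ε s(a.1.1, a.1.2) • p'.grad (flipArc S a)) :=
    (LinearIndependent.units_smul_iff (fun a : I => (p'.grad ∘ flipArc S) a)
      (fun a : I => ε s(a.1.1, a.1.2))).symm
  rw [h3, h4, h2, LinearIndepOn, h1, linearIndependent_toLp_iff_det,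
    linearIndependent_toLp_iff_det, map_det, map_det, map_ne_zero, map_ne_zero]

/-! ### Density of generic configurations and persistence of dependencies -/

namespace PseudorangeConfig

/-- Baire category: there are countably many integer polynomials, and each nonvanishing locus is
open and dense. -/
theorem dense_isGeneric {V : Type*} [Fintype V] {d : ℕ} :
    Dense {p : PseudorangeConfig V d | p.IsGeneric} := by
  classical
  have : {p : PseudorangeConfig V d | p.IsGeneric} =
      ⋂ P : {P : MvPolynomial (V × Fin d) ℤ // P ≠ 0}, {p : PseudorangeConfig V d |
        MvPolynomial.aeval (fun i : V × Fin d => p (Sum.inl i)) P.1 ≠ 0} := by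
    ext p
    simp [IsGeneric]
  rw [this]
  have : Countable (MvPolynomial (V × Fin d) ℤ) := by
    rw [← Cardinal.mk_le_aleph0_iff]
    refine MvPolynomial.cardinalMk_le_max_lift.trans ?_
    simpa using (Cardinal.mk_le_aleph0 : Cardinal.mk (V × Fin d) ≤ _)
  refine dense_iInter_of_isOpen (fun P => ?_) fun ⟨P, hP⟩ => ?_
  · refine isOpen_ne_fun ?_ continuous_const
    simp only [MvPolynomial.aeval_eq_eval₂Hom, MvPolynomial.coe_eval₂Hom, MvPolynomial.eval₂_eq]
    fun_prop
  · rw [dense_iff_inter_open]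
    rintro W hW ⟨p, hp⟩
    by_contra hne
    have hzero : ∀ q ∈ W,
        MvPolynomial.aeval (fun i : V × Fin d => q (Sum.inl i)) P = 0 := by
      intro q hq
      by_contra h
      exact hne ⟨q, hq, h⟩
    -- With the biases of `p` frozen, the polynomial would vanish on a product of intervals, hence
    -- identically.
    let g : (V × Fin d → ℝ) → PseudorangeConfig V d := fun x =>
      WithLp.toLp 2 (Sum.elim x fun v => p (Sum.inr v))
    have hg : Continuous g := by
      refine (PiLp.continuous_toLp 2 _).comp (continuous_pi ?_)
      rintro (i | v) <;> simp only [Sum.elim_inl, Sum.elim_inr] <;> fun_prop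
    let x₀ : V × Fin d → ℝ := fun i => p (Sum.inl i)
    have hx₀ : g x₀ = p := by
      ext (i | v) <;> rfl
    obtain ⟨ε, hε, hball⟩ := Metric.isOpen_iff.1 (hW.preimage hg) x₀
      (by rw [Set.mem_preimage, hx₀]; exact hp)
    refine hP (MvPolynomial.map_injective (Int.castRingHom ℝ) Int.cast_injective ?_)
    rw [map_zero]
    refine MvPolynomial.funext_set (fun i => Metric.ball (x₀ i) ε) (fun i => ?_) fun x hx => ?_
    · rw [Real.ball_eq_Ioo]
      exact Set.Ioo_infinite (by linarith)
    · have hxb : x ∈ Metric.ball x₀ ε := by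
        rw [ball_pi _ hε]
        exact hx
      have := hzero _ (hball hxb)
      rw [map_zero, MvPolynomial.eval_map]
      exact this

theorem IsGeneric.position_ne {V : Type*} {d : ℕ} (hd : 2 ≤ d)
    {p : PseudorangeConfig V d} (hp : p.IsGeneric) {u v : V} (huv : u ≠ v) :
    p.position u ≠ p.position v := by
  intro h
  let i : Fin d := ⟨0, by omega⟩
  refine hp (MvPolynomial.X (u, i) - MvPolynomial.X (v, i)) ?_ ?_
  · rw [sub_ne_zero]
    intro h
    exact huv (congrArg Prod.fst (MvPolynomial.X_injective h))
  · have := congrArg (fun x => x i) h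
    simpa [position, sub_eq_zero] using this

theorem continuous_position {V : Type*} [Fintype V] {d : ℕ} (u : V) :
    Continuous fun p : PseudorangeConfig V d => p.position u := by
  refine (PiLp.continuous_toLp 2 _).comp (continuous_pi fun i => ?_)
  fun_prop

theorem continuousAt_grad {V : Type*} [Fintype V] {d : ℕ} {p : PseudorangeConfig V d}
    {a : V × V} (h : p.position a.1 ≠ p.position a.2) :
    ContinuousAt (fun q : PseudorangeConfig V d => q.grad a) p := by
  refine (PiLp.continuous_toLp 2 _).continuousAt.comp (continuousAt_pi.2 ?_)
  have hn : ContinuousAt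
      (fun q : PseudorangeConfig V d => ‖q.position a.1 - q.position a.2‖) p :=
    ((continuous_position a.1).sub (continuous_position a.2)).norm.continuousAt
  have hne : ‖p.position a.1 - p.position a.2‖ ≠ 0 := by
    simpa [sub_eq_zero] using h
  rintro (⟨w, i⟩ | w)
  · simp only [rigidityRow]
    refine continuousAt_const.mul (ContinuousAt.div ?_ hn hne)
    fun_prop
  · simp only [rigidityRow]
    exact continuousAt_const

theorem eventually_position_ne {V : Type*} [Fintype V] {d : ℕ} {p : PseudorangeConfig V d}
    {u v : V} (h : p.position u ≠ p.position v) :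
    ∀ᶠ q in nhds p, PseudorangeConfig.position q u ≠ PseudorangeConfig.position q v :=
  (isOpen_ne_fun (continuous_position u) (continuous_position v)).mem_nhds h

theorem eventually_linearIndepOn_grad {V : Type*} [Fintype V] {d : ℕ}
    {p : PseudorangeConfig V d} {I : Set (V × V)}
    (hne : ∀ a ∈ I, p.position a.1 ≠ p.position a.2) (hI : LinearIndepOn ℝ p.grad I) :
    ∀ᶠ q in nhds p, LinearIndepOn ℝ (PseudorangeConfig.grad q) I := by
  have hc : ContinuousAt (fun (q : PseudorangeConfig V d) (a : I) => q.grad a) p :=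
    continuousAt_pi.2 fun a => continuousAt_grad (hne a a.2)
  exact hc.eventually_mem (isOpen_setOfPred_linearIndependent.mem_nhds hI)

/-- At a generic configuration, a linear dependency of gradients persists nearby. -/
theorem IsGeneric.eventually_grad_mem_span {V : Type*} [Fintype V] {d : ℕ} (hd : 2 ≤ d)
    {p : PseudorangeConfig V d} (hp : p.IsGeneric) {I : Set (V × V)}
    (hI : LinearIndepOn ℝ p.grad I) (hIne : ∀ a ∈ I, a.1 ≠ a.2) {a : V × V} (ha : a.1 ≠ a.2)
    (hspan : p.grad a ∈ Submodule.span ℝ (p.grad '' I)) :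
    ∀ᶠ q in nhds p, PseudorangeConfig.grad q a ∈
      Submodule.span ℝ (PseudorangeConfig.grad q '' I) := by
  by_cases haI : a ∈ I
  · exact Filter.Eventually.of_forall fun q => Submodule.subset_span ⟨a, haI, rfl⟩
  have hJ : ∀ b ∈ insert a I, b.1 ≠ b.2 := by
    rintro b (rfl | hb)
    exacts [ha, hIne b hb]
  have hdep : ∀ q : PseudorangeConfig V d, q.IsGeneric →
      ¬ LinearIndepOn ℝ q.grad (insert a I) := by
    intro q hq h
    have h' := (linearIndepOn_grad_iff hd hq hp ∅ _).1 h
    rw [flipArc_empty, Set.image_id] at h'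
    exact ((linearIndepOn_insert haI).1 h').2 hspan
  have hpos : ∀ᶠ q : PseudorangeConfig V d in nhds p,
      ∀ b : V × V, b ∈ insert a I → PseudorangeConfig.position q b.1 ≠
        PseudorangeConfig.position q b.2 :=
    Filter.eventually_all.2 fun b => by
      by_cases hb : b ∈ insert a I
      · filter_upwards [eventually_position_ne (hp.position_ne hd (hJ b hb))] with q hq _
        exact hq
      · exact Filter.Eventually.of_forall fun q h => absurd h hb
  filter_upwards [hpos, eventually_linearIndepOn_grad
    (fun b hb => hp.position_ne hd (hIne b hb)) hI] with q hq hqI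
  -- Independence at a possibly non-generic `q` is open, so it would reach a generic `r`,
  -- contradicting `hdep`.
  by_contra hqa
  have hqJ := (linearIndepOn_insert haI).2 ⟨hqI, hqa⟩
  obtain ⟨r, hr, hrg⟩ := dense_isGeneric.inter_nhds_nonempty
    (eventually_linearIndepOn_grad hq hqJ)
  exact hdep r hr hrg

end PseudorangeConfig

/-! ### Functions on the fibres of a submersion -/

/-- A local chart along the common fibre of finitely many `C¹` functions with linearly independent
gradients, parametrised by the values of the functions and by the orthogonal complement of the
gradients. -/
theorem exists_fibre_chart {E κ : Type*} [NormedAddCommGroup E] [InnerProductSpace ℝ E]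
    [FiniteDimensional ℝ E] [Fintype κ] {f : κ → E → ℝ} {G : κ → E} {p : E}
    (hf : ∀ k, ContDiffAt ℝ 1 (f k) p) (hG : ∀ k, HasFDerivAt (f k) (innerSL ℝ (G k)) p)
    (hli : LinearIndependent ℝ G) :
    ∃ (γ : (κ → ℝ) × ((Submodule.span ℝ (Set.range G))ᗮ : Submodule ℝ E) → E)
      (π : E →L[ℝ] ((Submodule.span ℝ (Set.range G))ᗮ : Submodule ℝ E)),
      ContDiffAt ℝ 1 γ (fun k => f k p, π p) ∧ γ (fun k => f k p, π p) = p ∧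
      (∀ᶠ z in nhds ((fun k => f k p, π p) : (κ → ℝ) × _), ∀ k, f k (γ z) = z.1 k) ∧
      (∀ᶠ q in nhds p, γ (fun k => f k q, π q) = q) ∧
      ∀ h, fderiv ℝ γ (fun k => f k p, π p) (0, h) = h := by
  set U := Submodule.span ℝ (Set.range G) with hU
  let π : E →L[ℝ] Uᗮ := Uᗮ.orthogonalProjectionOnto
  let f' : E →L[ℝ] (κ → ℝ) := ContinuousLinearMap.pi fun k => innerSL ℝ (G k)
  have hker : ∀ x, x ∈ f'.ker ↔ x ∈ Uᗮ := by
    intro x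
    rw [Submodule.mem_orthogonal]
    constructor
    · intro hx u hu
      induction hu using Submodule.span_induction with
      | mem u hu =>
        obtain ⟨k, rfl⟩ := hu
        exact congrFun hx k
      | zero => simp
      | add u v _ _ hu hv => rw [inner_add_left, hu, hv, add_zero]
      | smul c u _ hu => rw [real_inner_smul_left, hu, mul_zero]
    · intro hx
      exact funext fun k => hx _ (Submodule.subset_span ⟨k, rfl⟩)
  have hker' : f'.ker = Uᗮ := Submodule.ext hker
  have hsurj : f'.range = ⊤ := by
    apply Submodule.eq_top_of_finrank_eq
    have h1 := f'.toLinearMap.finrank_range_add_finrank_ker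
    have h2 := U.finrank_add_finrank_orthogonal
    have h3 : Module.finrank ℝ U = Fintype.card κ := finrank_span_eq_card hli
    have h4 : Module.finrank ℝ f'.ker = Module.finrank ℝ Uᗮ := by rw [hker']
    rw [Module.finrank_fintype_fun_eq_card]
    change Module.finrank ℝ f'.range + Module.finrank ℝ f'.ker = _ at h1
    omega
  have hπ : π.range = ⊤ := LinearMap.range_eq_top.2 fun x =>
    ⟨x, Submodule.orthogonalProjectionOnto_mem_subspace_eq_self x⟩
  have hcompl : IsCompl f'.ker π.ker := by
    rw [hker', Submodule.ker_orthogonalProjectionOnto]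
    exact Submodule.isCompl_orthogonal (K := Uᗮ)
  let e := f'.equivProdOfSurjectiveOfIsCompl π hsurj hπ hcompl
  -- The kernels of `f'` and `π` are `Uᗮ` and `U`, so `Φ` has invertible derivative at `p`; the
  -- chart `γ` is its local inverse.
  let Φ : E → (κ → ℝ) × Uᗮ := fun q => (fun k => f k q, π q)
  have hΦ : ContDiffAt ℝ 1 Φ p := (contDiffAt_pi.2 hf).prodMk π.contDiff.contDiffAt
  have hΦ' : HasFDerivAt Φ (e : E →L[ℝ] (κ → ℝ) × Uᗮ) p :=
    (hasFDerivAt_pi.2 hG).prodMk π.hasFDerivAt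
  have hs := hΦ.hasStrictFDerivAt' hΦ' one_ne_zero
  refine ⟨hΦ.localInverse hΦ' one_ne_zero, π, hΦ.to_localInverse hΦ' one_ne_zero,
    hΦ.localInverse_apply_image hΦ' one_ne_zero, ?_, hs.eventually_left_inverse, ?_⟩
  · filter_upwards [hs.eventually_right_inverse] with z hz k
    exact congrFun (congrArg Prod.fst hz) k
  · intro h
    have h1 : fderiv ℝ (hΦ.localInverse hΦ' one_ne_zero) (fun k => f k p, π p) =
        (e.symm : (κ → ℝ) × Uᗮ →L[ℝ] E) := hs.to_localInverse.hasFDerivAt.fderiv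
    rw [h1]
    change e.symm (0, h) = h
    rw [ContinuousLinearEquiv.symm_apply_eq]
    refine Prod.ext ?_ ?_
    · exact ((hker h).2 h.2).symm
    · exact (Submodule.orthogonalProjectionOnto_mem_subspace_eq_self h).symm

/-- A function whose derivative is dependent on the derivatives of the `f k` is locally constant
on the common fibre of the `f k`. -/
theorem eventually_eq_on_fibre {E κ : Type*} [NormedAddCommGroup E] [InnerProductSpace ℝ E]
    [FiniteDimensional ℝ E] [Fintype κ] {f : κ → E → ℝ} {G : κ → E} {p : E}
    (hf : ∀ k, ContDiffAt ℝ 1 (f k) p) (hG : ∀ k, HasFDerivAt (f k) (innerSL ℝ (G k)) p)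
    (hli : LinearIndependent ℝ G) {h : E → ℝ}
    (hdiff : ∀ᶠ q in nhds p, ∀ k, DifferentiableAt ℝ (f k) q)
    (hh : ∀ᶠ q in nhds p, DifferentiableAt ℝ h q)
    (hdep : ∀ᶠ q in nhds p, ∀ v, (∀ k, fderiv ℝ (f k) q v = 0) → fderiv ℝ h q v = 0) :
    ∀ᶠ q in nhds p, (∀ k, f k q = f k p) → h q = h p := by
  obtain ⟨γ, π, hγ, hγp, hfγ, hγf, -⟩ := exists_fibre_chart hf hG hli
  set c : κ → ℝ := fun k => f k p with hc
  have hγt : Filter.Tendsto γ (nhds (c, π p)) (nhds p) := by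
    have := hγ.continuousAt.tendsto
    rwa [hγp] at this
  have hev : ∀ᶠ z in nhds (c, π p), DifferentiableAt ℝ γ z ∧
      (∀ k, (fun z => f k (γ z)) =ᶠ[nhds z] fun z => z.1 k) ∧
      (∀ k, DifferentiableAt ℝ (f k) (γ z)) ∧ DifferentiableAt ℝ h (γ z) ∧
      ∀ v, (∀ k, fderiv ℝ (f k) (γ z) v = 0) → fderiv ℝ h (γ z) v = 0 := by
    filter_upwards [hγ.eventually (by simp), hfγ.eventually_nhds, hγt.eventually hdiff,
      hγt.eventually hh, hγt.eventually hdep] with z h1 h2 h3 h4 h5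
    exact ⟨h1.differentiableAt one_ne_zero, fun k => h2.mono fun w hw => hw k, h3, h4, h5⟩
  obtain ⟨ε, hε, hball⟩ := Metric.eventually_nhds_iff_ball.1 hev
  have hmem : ∀ y ∈ Metric.ball (π p) ε, (c, y) ∈ Metric.ball (c, π p) ε := by
    intro y hy
    rw [Metric.mem_ball, Prod.dist_eq, dist_self]
    exact max_lt hε hy
  have hderiv : ∀ y ∈ Metric.ball (π p) ε,
      HasFDerivAt (fun y => h (γ (c, y)))
        (0 : ((Submodule.span ℝ (Set.range G))ᗮ : Submodule ℝ E) →L[ℝ] ℝ) y := by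
    intro y hy
    obtain ⟨h1, h2, h3, h4, h5⟩ := hball _ (hmem y hy)
    have hι : HasFDerivAt (fun y : ((Submodule.span ℝ (Set.range G))ᗮ : Submodule ℝ E) => (c, y))
        (ContinuousLinearMap.inr ℝ (κ → ℝ) _) y := hasFDerivAt_prodMk_right c y
    have hcomp := h4.hasFDerivAt.comp y (h1.hasFDerivAt.comp y hι)
    refine hcomp.congr_fderiv ?_
    ext w
    -- Along the slice `(c, y)` each `f k ∘ γ` is constant, so the image of `w` under the derivative
    -- of `γ` is killed by every `f k`, hence by `h`.
    refine h5 _ fun k => ?_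
    have hk := (h3 k).hasFDerivAt.comp (c, y) h1.hasFDerivAt
    have hk' := (hasFDerivAt_apply (𝕜 := ℝ) k c).comp (c, y)
      (hasFDerivAt_fst (𝕜 := ℝ) (p := (c, y)))
    have := hk.unique (hk'.congr_of_eventuallyEq (h2 k))
    exact congrArg (fun L => L (0, w)) this
  have hconst : ∀ y ∈ Metric.ball (π p) ε, h (γ (c, y)) = h p := by
    intro y hy
    have := Metric.isOpen_ball.is_const_of_fderiv_eq_zero (convex_ball (π p) ε).isPreconnected
      (fun y hy => (hderiv y hy).differentiableAt.differentiableWithinAt)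
      (fun y hy => (hderiv y hy).fderiv) hy (Metric.mem_ball_self hε)
    simpa only [hγp] using this
  filter_upwards [hγf, π.continuous.continuousAt.eventually_mem (Metric.ball_mem_nhds (π p) hε)]
    with q hq hqπ hqf
  have hcq : (fun k => f k q) = c := funext hqf
  rw [← hconst (π q) hqπ, ← hcq, hq]

/-- A function whose derivative is independent of the derivatives of the `f k` is not locally
constant on the common fibre of the `f k`. -/
theorem frequently_ne_on_fibre {E κ : Type*} [NormedAddCommGroup E] [InnerProductSpace ℝ E]
    [FiniteDimensional ℝ E] [Fintype κ] {f : κ → E → ℝ} {G : κ → E} {p : E}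
    (hf : ∀ k, ContDiffAt ℝ 1 (f k) p) (hG : ∀ k, HasFDerivAt (f k) (innerSL ℝ (G k)) p)
    (hli : LinearIndependent ℝ G) {h : E → ℝ} {H : E} (hh : HasFDerivAt h (innerSL ℝ H) p)
    (hH : H ∉ Submodule.span ℝ (Set.range G)) :
    ∃ᶠ q in nhds p, (∀ k, f k q = f k p) ∧ h q ≠ h p := by
  obtain ⟨γ, π, hγ, hγp, hfγ, -, hγ'⟩ := exists_fibre_chart hf hG hli
  set c : κ → ℝ := fun k => f k p with hc
  obtain ⟨v, hv, hvH⟩ : ∃ v ∈ (Submodule.span ℝ (Set.range G))ᗮ, inner ℝ H v ≠ 0 := by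
    by_contra! hcon
    apply hH
    rw [← Submodule.orthogonal_orthogonal (Submodule.span ℝ (Set.range G)),
      Submodule.mem_orthogonal]
    exact fun u hu => by rw [real_inner_comm]; exact hcon u hu
  -- The curve `γ ∘ ℓ` stays in the fibre and leaves `p` with velocity `v`, so `h` changes along it
  -- at the nonzero rate `⟨H, v⟩`.
  let ℓ : ℝ → (κ → ℝ) × ((Submodule.span ℝ (Set.range G))ᗮ : Submodule ℝ E) :=
    fun t => (c, π p + t • ⟨v, hv⟩)
  have hℓ0 : ℓ 0 = (c, π p) := by simp [ℓ]
  have hℓ : HasDerivAt ℓ (0, ⟨v, hv⟩) 0 := by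
    refine (hasDerivAt_const 0 c).prodMk ?_
    simpa using ((hasDerivAt_id (0 : ℝ)).smul_const
      (⟨v, hv⟩ : ((Submodule.span ℝ (Set.range G))ᗮ : Submodule ℝ E))).const_add (π p)
  have hγd : HasFDerivAt γ (fderiv ℝ γ (c, π p)) (ℓ 0) := by
    rw [hℓ0]
    exact (hγ.differentiableAt one_ne_zero).hasFDerivAt
  have hγℓ : HasDerivAt (γ ∘ ℓ) v 0 := by
    have := hγd.comp_hasDerivAt (0 : ℝ) hℓ
    rwa [hγ'] at this
  have hγℓ0 : (γ ∘ ℓ) 0 = p := by rw [Function.comp_apply, hℓ0, hγp]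
  have hd : HasDerivAt (h ∘ (γ ∘ ℓ)) (inner ℝ H v) 0 := by
    rw [← hγℓ0] at hh
    exact hh.comp_hasDerivAt (0 : ℝ) hγℓ
  have htend : Filter.Tendsto (γ ∘ ℓ) (nhdsWithin 0 {0}ᶜ) (nhds p) := by
    have := hγℓ.continuousAt.tendsto
    rw [hγℓ0] at this
    exact this.mono_left nhdsWithin_le_nhds
  have hℓt : Filter.Tendsto ℓ (nhdsWithin 0 {0}ᶜ) (nhds (c, π p)) := by
    have := hℓ.continuousAt.tendsto
    rw [hℓ0] at this
    exact this.mono_left nhdsWithin_le_nhds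
  refine htend.frequently (Filter.Eventually.frequently ?_)
  filter_upwards [hd.eventually_ne (c := h p) hvH, hℓt.eventually hfγ] with t ht htf
  exact ⟨fun k => htf k, ht⟩

/-! ### Differentiating pseudoranges -/

namespace PseudorangeConfig

theorem exists_clm_eq_position_sub {V : Type*} [Fintype V] {d : ℕ} (u v : V) :
    ∃ A : PseudorangeConfig V d →L[ℝ] EuclideanSpace ℝ (Fin d),
      ∀ q, A q = PseudorangeConfig.position q u - PseudorangeConfig.position q v :=
  ⟨LinearMap.toContinuousLinearMap
    { toFun := fun q => PseudorangeConfig.position q u - PseudorangeConfig.position q v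
      map_add' := fun q r => by ext i; simp [position]; ring
      map_smul' := fun c q => by ext i; simp [position]; ring }, fun _ => rfl⟩

theorem inner_grad {V : Type*} [Fintype V] {d : ℕ} (p w : PseudorangeConfig V d) (u v : V) :
    inner ℝ (p.grad (u, v)) w = inner ℝ (p.position u - p.position v)
      (w.position u - w.position v) / ‖p.position u - p.position v‖ + w.bias v - w.bias u := by
  classical
  simp only [PiLp.inner_apply, grad, Fintype.sum_sum_type, Fintype.sum_prod_type, rigidityRow,
    RCLike.inner_apply, conj_trivial, position, bias, sub_mul, mul_sub, ite_mul, mul_ite, one_mul,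
    mul_one, zero_mul, mul_zero, Finset.sum_sub_distrib, PiLp.sub_apply]
  rw [Finset.sum_comm, Finset.sum_comm (s := Finset.univ (α := V))]
  simp only [Finset.sum_ite_eq', Finset.mem_univ, if_true]
  rw [add_sub_assoc, ← Finset.sum_sub_distrib, ← Finset.sum_sub_distrib,
    ← Finset.sum_sub_distrib, ← Finset.sum_sub_distrib, Finset.sum_div]
  congr 1
  refine Finset.sum_congr rfl fun i _ => ?_
  ring

theorem hasFDerivAt_pseudorange {V : Type*} [Fintype V] {d : ℕ} {p : PseudorangeConfig V d}
    {u v : V} (h : p.position u ≠ p.position v) :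
    HasFDerivAt (fun q : PseudorangeConfig V d => q.pseudorange u v)
      (innerSL ℝ (p.grad (u, v))) p := by
  obtain ⟨A, hA⟩ := exists_clm_eq_position_sub (d := d) u v
  have hne : ‖A p‖ ^ 2 ≠ 0 := by
    rw [hA]
    simpa [sub_eq_zero] using h
  -- Writing the norm as the root of its square yields the derivative as an explicit inner product
  -- over the length.
  have hn : HasFDerivAt (fun q => √(‖A q‖ ^ 2)) _ p := (A.hasFDerivAt (x := p)).norm_sq.sqrt hne
  have hb : ∀ w : V, HasFDerivAt (fun q : PseudorangeConfig V d => q.bias w)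
      (EuclideanSpace.proj (𝕜 := ℝ) (Sum.inr w : (V × Fin d) ⊕ V)) p := fun w =>
    (EuclideanSpace.proj (𝕜 := ℝ) (Sum.inr w : (V × Fin d) ⊕ V)).hasFDerivAt
  have := (hn.add (hb v)).sub (hb u)
  refine (this.congr_fderiv ?_).congr_of_eventuallyEq (Filter.Eventually.of_forall fun q => ?_)
  · ext w
    rw [innerSL_apply_apply, inner_grad, ← hA, ← hA]
    simp [bias]
    ring
  · simp [pseudorange, hA]

theorem contDiffAt_pseudorange {V : Type*} [Fintype V] {d : ℕ} {p : PseudorangeConfig V d}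
    {u v : V} (h : p.position u ≠ p.position v) :
    ContDiffAt ℝ 1 (fun q : PseudorangeConfig V d => q.pseudorange u v) p := by
  obtain ⟨A, hA⟩ := exists_clm_eq_position_sub (d := d) u v
  have hn : ContDiffAt ℝ 1 (fun q => ‖A q‖) p :=
    A.contDiff.contDiffAt.norm ℝ (by rw [hA]; exact sub_ne_zero.2 h)
  have hb : ∀ w : V, ContDiffAt ℝ 1 (fun q : PseudorangeConfig V d => q.bias w) p := fun w =>
    (EuclideanSpace.proj (𝕜 := ℝ) (Sum.inr w : (V × Fin d) ⊕ V)).contDiff.contDiffAt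
  refine ((hn.add (hb v)).sub (hb u)).congr_of_eventuallyEq
    (Filter.Eventually.of_forall fun q => ?_)
  simp [pseudorange, hA]

/-- Near a generic configuration, a pseudorange whose gradient depends on the gradients along the
independent arcs `I` is determined by the pseudoranges along `I`. -/
theorem IsGeneric.eventually_pseudorange_eq {V : Type*} [Fintype V] {d : ℕ} (hd : 2 ≤ d)
    {p : PseudorangeConfig V d} (hp : p.IsGeneric) {I : Set (V × V)}
    (hI : LinearIndepOn ℝ p.grad I) (hIne : ∀ a ∈ I, a.1 ≠ a.2) {a : V × V} (ha : a.1 ≠ a.2)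
    (hspan : p.grad a ∈ Submodule.span ℝ (p.grad '' I)) :
    ∀ᶠ q : PseudorangeConfig V d in nhds p,
      (∀ b ∈ I, q.pseudorange b.1 b.2 = p.pseudorange b.1 b.2) →
        q.pseudorange a.1 a.2 = p.pseudorange a.1 a.2 := by
  classical
  have hpos : ∀ b : I, p.position b.1.1 ≠ p.position b.1.2 := fun b =>
    hp.position_ne hd (hIne b b.2)
  have hev : ∀ᶠ q : PseudorangeConfig V d in nhds p,
      ∀ b : I, q.position b.1.1 ≠ q.position b.1.2 :=
    Filter.eventually_all.2 fun b => eventually_position_ne (hpos b)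
  have heva := eventually_position_ne (hp.position_ne hd ha)
  have := eventually_eq_on_fibre (p := p) (G := fun b : I => p.grad b.1)
    (f := fun (b : I) q => PseudorangeConfig.pseudorange q b.1.1 b.1.2)
    (h := fun q => PseudorangeConfig.pseudorange q a.1 a.2)
    (fun b => contDiffAt_pseudorange (hpos b)) (fun b => hasFDerivAt_pseudorange (hpos b)) hI
    (hev.mono fun q hq b => (hasFDerivAt_pseudorange (hq b)).differentiableAt)
    (heva.mono fun q hq => (hasFDerivAt_pseudorange hq).differentiableAt) ?_
  · filter_upwards [this] with q hq hqI
    exact hq fun b => hqI b b.2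
  · filter_upwards [hev, heva, hp.eventually_grad_mem_span hd hI hIne ha hspan]
      with q hq hqa hqs w hw
    rw [(hasFDerivAt_pseudorange hqa).fderiv]
    rw [Prod.mk.eta]
    generalize PseudorangeConfig.grad q a = g at hqs ⊢
    induction hqs using Submodule.span_induction with
    | mem x hx =>
      obtain ⟨b, hb, rfl⟩ := hx
      have := hw ⟨b, hb⟩
      rwa [(hasFDerivAt_pseudorange (hq ⟨b, hb⟩)).fderiv] at this
    | zero => simp
    | add x y _ _ hx hy => rw [map_add, add_apply, hx, hy, add_zero]
    | smul c x _ hx => rw [map_smul, smul_apply, hx, smul_zero]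

end PseudorangeConfig

/-! ### Rigidity, infinitesimal rigidity and the underlying multigraph -/

namespace PseudorangeGraph

/-- Some linearly independent arcs of `Γ` span the gradients of all the pseudoranges: the
framework `(Γ, p)` is infinitesimally rigid. -/
def IsInfinitesimallyRigid {V : Type*} {d : ℕ} (Γ : PseudorangeGraph V)
    (p : PseudorangeConfig V d) : Prop :=
  ∃ I : Set (V × V), (∀ a ∈ I, Γ.Adj a.1 a.2) ∧ LinearIndepOn ℝ p.grad I ∧
    ∀ a : V × V, a.1 ≠ a.2 → p.grad a ∈ Submodule.span ℝ (p.grad '' I)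

theorem Adj.ne {V : Type*} {Γ : PseudorangeGraph V} {u v : V} (h : Γ.Adj u v) : u ≠ v := by
  rintro rfl
  exact Γ.loopless _ h

theorem isRigid_iff_isInfinitesimallyRigid {V : Type*} [Fintype V] {d : ℕ} (hd : 2 ≤ d)
    (Γ : PseudorangeGraph V) {p : PseudorangeConfig V d} (hp : p.IsGeneric) :
    Γ.IsRigid p ↔ Γ.IsInfinitesimallyRigid p := by
  classical
  constructor
  · rintro ⟨ε, hε, hrigid⟩
    by_contra hinf
    -- A maximal independent set of arcs: the other arcs of `Γ` are then locally determined by `I`,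
    -- so moving along the fibre of `I` while changing the pseudorange of some `a` gives equivalent,
    -- non-congruent configurations.
    obtain ⟨I, hIΓ, -, hIspan, hI⟩ := exists_linearIndepOn_extension
      (linearIndepOn_empty ℝ p.grad) (Set.empty_subset {a : V × V | Γ.Adj a.1 a.2})
    have hIne : ∀ a ∈ I, a.1 ≠ a.2 := fun a ha => Adj.ne (hIΓ ha)
    obtain ⟨a, ha, haI⟩ : ∃ a : V × V, a.1 ≠ a.2 ∧
        p.grad a ∉ Submodule.span ℝ (p.grad '' I) := by
      by_contra! hcon
      exact hinf ⟨I, fun a ha => hIΓ ha, hI, hcon⟩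
    have hfreq := frequently_ne_on_fibre (p := p) (G := fun b : I => p.grad b.1)
      (f := fun (b : I) q => PseudorangeConfig.pseudorange q b.1.1 b.1.2)
      (h := fun q => PseudorangeConfig.pseudorange q a.1 a.2) (H := p.grad a)
      (fun b => PseudorangeConfig.contDiffAt_pseudorange (hp.position_ne hd (hIne b b.2)))
      (fun b => PseudorangeConfig.hasFDerivAt_pseudorange (hp.position_ne hd (hIne b b.2))) hI
      (PseudorangeConfig.hasFDerivAt_pseudorange (hp.position_ne hd ha))
      (by rwa [← Set.image_eq_range])
    have hΓ : ∀ᶠ q : PseudorangeConfig V d in nhds p, ∀ c : V × V, Γ.Adj c.1 c.2 →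
        (∀ b ∈ I, q.pseudorange b.1 b.2 = p.pseudorange b.1 b.2) →
          q.pseudorange c.1 c.2 = p.pseudorange c.1 c.2 :=
      Filter.eventually_all.2 fun c => by
        by_cases hc : Γ.Adj c.1 c.2
        · filter_upwards [hp.eventually_pseudorange_eq hd hI hIne (Adj.ne hc)
            (hIspan ⟨c, hc, rfl⟩)] with q hq _
          exact hq
        · exact Filter.Eventually.of_forall fun q h => absurd h hc
    obtain ⟨q, ⟨hqI, hqa⟩, hqΓ, hqε⟩ :=
      (hfreq.and_eventually (hΓ.and (Metric.ball_mem_nhds p hε))).exists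
    refine hqa (hrigid q ?_ (fun u v huv => ?_) a.1 a.2 ha).symm
    · rwa [← dist_eq_norm, dist_comm]
    · exact (hqΓ (u, v) huv fun b hb => hqI ⟨b, hb⟩).symm
  · rintro ⟨I, hIΓ, hI, hspan⟩
    have hIne : ∀ a ∈ I, a.1 ≠ a.2 := fun a ha => Adj.ne (hIΓ a ha)
    have hev : ∀ᶠ q : PseudorangeConfig V d in nhds p, ∀ a : V × V, a.1 ≠ a.2 →
        (∀ b ∈ I, q.pseudorange b.1 b.2 = p.pseudorange b.1 b.2) →
          q.pseudorange a.1 a.2 = p.pseudorange a.1 a.2 :=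
      Filter.eventually_all.2 fun a => by
        by_cases ha : a.1 = a.2
        · exact Filter.Eventually.of_forall fun q h => absurd ha h
        · filter_upwards [hp.eventually_pseudorange_eq hd hI hIne ha (hspan a ha)] with q hq _
          exact hq
    obtain ⟨ε, hε, hball⟩ := Metric.eventually_nhds_iff.1 hev
    refine ⟨ε, hε, fun q hq heq u v huv => ?_⟩
    rw [← dist_eq_norm, dist_comm] at hq
    exact (hball hq (u, v) huv fun b hb => (heq b.1 b.2 (hIΓ b hb)).symm).symm

open Classical in
theorem count_underlying {V : Type*} [Fintype V] (Γ : PseudorangeGraph V) {u v : V}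
    (huv : u ≠ v) :
    Γ.underlying.count s(u, v) =
      (if Γ.Adj u v then 1 else 0) + (if Γ.Adj v u then 1 else 0) := by
  rw [underlying, Multiset.count_map, ← Finset.filter_val, Finset.card_val]
  have : (Finset.univ.filter fun a : V × V => Γ.Adj a.1 a.2).filter
      (fun a => s(u, v) = s(a.1, a.2)) =
      ({(u, v)} : Finset (V × V)).filter (fun a => Γ.Adj a.1 a.2) ∪
        ({(v, u)} : Finset (V × V)).filter (fun a => Γ.Adj a.1 a.2) := by
    ext ⟨x, y⟩
    simp only [Finset.mem_filter, Finset.mem_univ, true_and, Finset.mem_union,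
      Finset.mem_singleton, Sym2.eq_iff, Prod.mk.injEq]
    tauto
  rw [this, Finset.card_union_of_disjoint]
  · simp only [Finset.filter_singleton, apply_ite Finset.card, Finset.card_singleton,
      Finset.card_empty]
  · refine Finset.disjoint_filter_filter ?_
    simp [huv]

/-- Two digraphs with the same underlying undirected multigraph differ by the reversal of arcs. -/
theorem exists_flipArc_of_underlying_eq {V : Type*} [Fintype V] {Γ Γ' : PseudorangeGraph V}
    (h : Γ.underlying = Γ'.underlying) :
    ∃ S : Set (Sym2 V), ∀ a : V × V, Γ.Adj a.1 a.2 →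
      Γ'.Adj (flipArc S a).1 (flipArc S a).2 := by
  classical
  -- Counting multiplicities, such a pair has multiplicity one and is oriented oppositely in `Γ` and
  -- `Γ'`; double edges are never flipped.
  refine ⟨{e | ∃ u v, e = s(u, v) ∧ Γ.Adj u v ∧ ¬ Γ'.Adj u v}, ?_⟩
  rintro ⟨u, v⟩ huv
  have hc := congrArg (Multiset.count s(u, v)) h
  have huv' : Γ.Adj u v := huv
  rw [count_underlying _ (Adj.ne huv), count_underlying _ (Adj.ne huv), if_pos huv'] at hc
  unfold flipArc
  split_ifs with hS
  · obtain ⟨x, y, hxy, h1, h2⟩ := hS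
    rcases Sym2.eq_iff.1 hxy with ⟨rfl, rfl⟩ | ⟨rfl, rfl⟩
    · change Γ'.Adj v u
      by_contra h3
      simp [h2, h3] at hc
    · rw [if_pos h1, if_neg h2] at hc
      split_ifs at hc <;> omega
  · by_contra h2
    exact hS ⟨u, v, rfl, huv, h2⟩

/-- Spanning is a statement about independence too: adjoining any further arc to `I` destroys it.
Both properties therefore transfer through `linearIndepOn_grad_iff`. -/
theorem IsInfinitesimallyRigid.of_underlying_eq {V : Type*} [Fintype V] {d : ℕ} (hd : 2 ≤ d)
    {Γ Γ' : PseudorangeGraph V} {p p' : PseudorangeConfig V d} (hp : p.IsGeneric)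
    (hp' : p'.IsGeneric) (h : Γ.underlying = Γ'.underlying) (hΓ : Γ.IsInfinitesimallyRigid p) :
    Γ'.IsInfinitesimallyRigid p' := by
  obtain ⟨S, hS⟩ := exists_flipArc_of_underlying_eq h
  obtain ⟨I, hIΓ, hI, hspan⟩ := hΓ
  have hI' := (linearIndepOn_grad_iff hd hp hp' S I).1 hI
  refine ⟨flipArc S '' I, ?_, hI', fun a ha => ?_⟩
  · rintro _ ⟨a, ha, rfl⟩
    exact hS a (hIΓ a ha)
  · by_contra hna
    have haI : a ∉ flipArc S '' I := fun h => hna (Submodule.subset_span ⟨a, h, rfl⟩)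
    have hins := (linearIndepOn_insert haI).2 ⟨hI', hna⟩
    rw [← flipArc_flipArc S a, ← Set.image_insert_eq,
      ← linearIndepOn_grad_iff hd hp hp'] at hins
    have hfI : flipArc S a ∉ I := fun h => haI ⟨_, h, flipArc_flipArc S a⟩
    refine ((linearIndepOn_insert hfI).1 hins).2 (hspan _ ?_)
    unfold flipArc
    split_ifs
    exacts [ha.symm, ha]

end PseudorangeGraph

theorem corollary1 {V : Type*} [Fintype V] (d : ℕ) (hd : 2 ≤ d) (E : Multiset (Sym2 V))
    (hE : IsUndirectedPseudorangeGraph E) :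
    Xor (IsRigidUndirectedGraph d E)
      (∀ (Γ : PseudorangeGraph V) (p : PseudorangeConfig V d),
        Γ.underlying = E → p.IsGeneric → ¬ Γ.IsRigid p) := by
  -- One actual generic framework is needed so that the two alternatives cannot both hold vacuously.
  obtain ⟨Γ₀, hΓ₀⟩ := hE
  obtain ⟨p₀, hp₀⟩ := (PseudorangeConfig.dense_isGeneric (V := V) (d := d)).nonempty
  have transfer : ∀ (Γ Γ' : PseudorangeGraph V) (p p' : PseudorangeConfig V d),
      Γ.underlying = E → Γ'.underlying = E → p.IsGeneric → p'.IsGeneric →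
        Γ.IsRigid p → Γ'.IsRigid p' := by
    intro Γ Γ' p p' hΓ hΓ' hp hp' hr
    rw [PseudorangeGraph.isRigid_iff_isInfinitesimallyRigid hd _ hp] at hr
    rw [PseudorangeGraph.isRigid_iff_isInfinitesimallyRigid hd _ hp']
    exact hr.of_underlying_eq hd hp hp' (hΓ.trans hΓ'.symm)
  by_cases h : Γ₀.IsRigid p₀
  · exact Or.inl ⟨fun Γ p hΓ hp => transfer Γ₀ Γ p₀ p hΓ₀ hΓ hp₀ hp h,
      fun hno => hno Γ₀ p₀ hΓ₀ hp₀ h⟩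
  · exact Or.inr ⟨fun Γ p hΓ hp hr => h (transfer Γ Γ₀ p p₀ hΓ hΓ₀ hp hp₀ hr),
      fun hall => h (hall Γ₀ p₀ hΓ₀ hp₀)⟩
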